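/- **Setting.** For an integer $n\ge 1$, a real $d>1$ with $d\le n$ and an integer $N\ge 0$, a *pseudo-elementary path* $P=u_1,\dots,u_N$ (with $|P|=N$ vertices) is the following random structure. Let $G_1,\dots,G_N$ be independent instances of the binomial random graph $G(n-1,d/n)$. For each $i$, every vertex of $G_i$ becomes adjacent to $u_i$ (and to no other path vertex) with probability $d/n$, independently of everything else. Consecutive vertices $u_i,u_{i+1}$ are adjacent. Let $\Delta(x)$ be the degree of a vertex $x$ in the resulting graph. For parameters $\alpha,\gamma,c>0$ put $$W(x)=\begin{cases}(1+\gamma)^{-1}&\text{if }\Delta(x)\le(1+\alpha)d,\\ d^{c}\,\Delta(x)&\text{otherwise.}\end{cases}$$ For a vertex $w\notin P$ let $E_{out}(w)$ be the maximum of $\prod_{x\in M}W(x)$ over all self-avoiding paths $M$ that start from $w$, have length (number of edges) at most $\ln n/d^{2/5}$, and use no vertex of $P$. For $u\in P$ let $Q(u)=\max E_{out}(w)$ over the neighbours $w\notin P$ of $u$ (if there are none, $\max\{1,Q(u)\}$ is read as $1$), and let $$U(u)=\begin{cases}\max\{1,Q(u)\}/(1+\gamma)&\text{if }\Delta(u)\le(1+\alpha)d,\\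 \max\{1,Q(u)\}\cdot d^{c}\cdot\Delta(u)&\text{otherwise.}\end{cases}$$ Finally let $AC(P)=\prod_{u\in P}U(u)$. **Theorem.** Fix $\alpha\in(0,3/2)$, $\gamma>0$, $c>0$ and $\theta\in[0,1)$. For every sufficiently large $d$ (depending only on $\alpha,\gamma,c,\theta$) and every sufficiently large $n$ (depending only on these and $d$), the following holds for every pseudo-elementary path $P$ with $|P|\le\frac{\ln n}{\ln^2 d}$ and every real $\delta\ge(1+\gamma)^{-\theta|P|}$ (in particular for every $\delta\ge 1$): $$\Pr[AC(P)\ge\delta]\le 2\exp\left[-d^{7/10}\left(|P|+\ln\delta\right)\right].$$ -/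

import Mathlib

open MeasureTheory ProbabilityTheory unitInterval

noncomputable section

namespace WeightedPath

/-! ### The weighting schema, on an arbitrary graph -/

section Schema

variable {V : Type*}

/-- The degree `Δ(v)` (used for finite graphs only). -/
def deg (G : SimpleGraph V) (v : V) : ℕ := (G.neighborSet v).ncard

open Classical in
/-- The basic weight `W(v)`: `(1+γ)⁻¹` if `Δ(v) ≤ (1+α)d`, and `d^c · Δ(v)` otherwise. -/
def vertexWeight (G : SimpleGraph V) (d α γ c : ℝ) (v : V) : ℝ :=
  if (deg G v : ℝ) ≤ (1 + α) * d then (1 + γ)⁻¹ else d ^ c * (deg G v : ℝ)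

/-- The products `∏_{x ∈ M} W(x)`, where `M` ranges over the (self-avoiding) paths of `G` that start
from `w`, have at most `ℓ` edges and do not use vertices of `L`. -/
def outsidePathWeights (G : SimpleGraph V) (L : Set V) (ℓ d α γ c : ℝ) (w : V) : Set ℝ :=
  {r | ∃ (x : V) (M : G.Walk w x), M.IsPath ∧ (M.length : ℝ) ≤ ℓ ∧ (∀ y ∈ M.support, y ∉ L) ∧
    r = (M.support.map (vertexWeight G d α γ c)).prod}

/-- `E_out(w)`: the influence on `w` from paths that do not use vertices of `L`.
On a finite graph this is a maximum over a finite set, non-empty if `w ∉ L` and `0 ≤ ℓ`. -/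
def outsideInfluence (G : SimpleGraph V) (L : Set V) (ℓ d α γ c : ℝ) (w : V) : ℝ :=
  sSup (outsidePathWeights G L ℓ d α γ c w)

/-- `Q(v) = max {E_out(w) : w ∉ L adjacent to v}`. If `v` has no neighbour outside `L` the value
is `0`, so that `max {1, Q(v)} = 1`. -/
def maxOutsideInfluence (G : SimpleGraph V) (L : Set V) (ℓ d α γ c : ℝ) (v : V) : ℝ :=
  sSup (outsideInfluence G L ℓ d α γ c '' {w | G.Adj v w ∧ w ∉ L})

open Classical in
/-- The augmented weight `U(v)`. -/
def augmentedWeight (G : SimpleGraph V) (L : Set V) (ℓ d α γ c : ℝ) (v : V) : ℝ :=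
  if (deg G v : ℝ) ≤ (1 + α) * d then
    max 1 (maxOutsideInfluence G L ℓ d α γ c v) / (1 + γ)
  else
    max 1 (maxOutsideInfluence G L ℓ d α γ c v) * d ^ c * (deg G v : ℝ)

end Schema

/-! ### Pseudo-elementary paths -/

/-- The outcomes of the random experiment for a path with `N` vertices `u_1, …, u_N`: for each `i`
a graph `G_i` on `m` vertices and the set of vertices of `G_i` that are adjacent to `u_i`. -/
abbrev Outcome (N m : ℕ) : Type := Fin N → SimpleGraph (Fin m) × Set (Fin m)

/-- The law of the experiment: the `G_i` are independent binomial random graphs `G(m, p)`, and every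
vertex of `G_i` becomes adjacent to `u_i` independently with probability `p`. -/
def law (N m : ℕ) (p : I) : Measure (Outcome N m) :=
  Measure.pi fun _ =>
    (SimpleGraph.binomialRandom (Fin m) p).prod (setBernoulli (Set.univ : Set (Fin m)) p)

/-- Adjacency in the graph that contains the path: `(i, none)` is the path vertex `u_i` and
`(i, some a)` is the vertex `a` of `G_i`. Consecutive path vertices are adjacent. -/
def adjRel {N m : ℕ} (ω : Outcome N m) : Fin N × Option (Fin m) → Fin N × Option (Fin m) → Prop
  | (i, none), (j, none) => i.val + 1 = j.val ∨ j.val + 1 = i.val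
  | (i, none), (j, some b) => i = j ∧ b ∈ (ω i).2
  | (i, some a), (j, none) => i = j ∧ a ∈ (ω j).2
  | (i, some a), (j, some b) => i = j ∧ (ω i).1.Adj a b

/-- The graph that contains the pseudo-elementary path. -/
def graph {N m : ℕ} (ω : Outcome N m) : SimpleGraph (Fin N × Option (Fin m)) where
  Adj := adjRel ω
  symm := ⟨by
    rintro ⟨i, _ | a⟩ ⟨j, _ | b⟩ h
    · exact Or.symm h
    · exact ⟨h.1.symm, h.2⟩
    · exact ⟨h.1.symm, h.2⟩
    · obtain ⟨rfl, h⟩ := h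
      exact ⟨rfl, h.symm⟩⟩
  loopless := ⟨by
    rintro ⟨i, _ | a⟩ h
    · rcases h with h | h <;> omega
    · exact (ω i).1.loopless.irrefl a h.2⟩

/-- The vertex set `{u_1, …, u_N}` of the path. -/
def pathVertices (N m : ℕ) : Set (Fin N × Option (Fin m)) := {x | x.2 = none}

/-- `AC(P) = ∏_{u ∈ P} U(u)` for the path `P = u_1, …, u_N`. Each `G_i` has `n - 1` vertices, and
the outside influence is taken over paths of length at most `ln n / d^{2/5}`. -/
def AC {N : ℕ} (n : ℕ) (d α γ c : ℝ) (ω : Outcome N (n - 1)) : ℝ :=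
  ∏ i : Fin N, augmentedWeight (graph ω) (pathVertices N (n - 1))
    (Real.log n / d ^ (2 / 5 : ℝ)) d α γ c (i, none)

end WeightedPath

end

/-! The proof bounds a moment of `AC` of high order `t = K d^(7/10)` and applies Markov's
inequality. Put `ρ = (1+γ)^(-t)`. For `l = α/4` and a suitable `A` exponentially small in `d`, every
weight satisfies `W(x)^t ≤ ρ (1 + A e^{lΔ(x)})`: a light vertex accounts for the `1`, and for a
heavy one `(d^c Δ (1+γ))^t = exp(O(d^(7/10) log Δ))` is beaten by the exponential
(`eventually_weight_le_exp`). The exponential moment of a degree is about `exp(d(e^l - 1))`, and `A`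
is small enough to cancel it, so heavy degrees cost only a constant factor per vertex.

The maximum over outside paths is at most the sum over them. A path with `k + 1` vertices needs `k +
1` edges, counting the one to `u_i`, so its expected contribution is at most `2 (2ρ p
e^{2l})^(k+1)`. There are at most `m^(k+1)` vertex sequences, and `ρ` beats the branching factor `pm
≤ d`, so the total is a geometric series of ratio at most `1/3`. Hence `E[U(u_i)^t] ≤ 3ρ`
(`integral_degreeFactor_attachedPathSum_le`, `augmentedWeight_rpow_le`).

The blocks are independent, so `E[AC^t] ≤ (3ρ)^N`. Markov gives `(3ρ)^N δ^(-t)`, and `K` is chosen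
so that this is at most `exp(-d^(7/10) (N + ln δ))` for every `δ ≥ (1+γ)^(-θN)`
(`three_pow_mul_rpow_le`). -/

namespace WeightedPath

/-! ### Product moments of Bernoulli random sets. -/

section Bernoulli

variable {ι : Type*} [Fintype ι]

open Classical in
/-- The mean of a product of functions of the independent coordinates of a Bernoulli set. -/
theorem integral_setBernoulli_prod (u : Set ι) (p : I) (a b : ι → ℝ) :
    ∫ s, ∏ i, (if i ∈ s then a i else b i) ∂(setBernoulli u p) =
      ∏ i, (if i ∈ u then (p : ℝ) * a i + (1 - p) * b i else b i) := by
  rw [setBernoulli_eq_map, Measure.infinitePi_eq_pi, integral_map (by fun_prop)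
    (by exact (measurable_of_finite _).aestronglyMeasurable)]
  simp only [Set.mem_ofPred_eq]
  rw [integral_fintype_prod_eq_prod (𝕜 := ℝ) (fun i (x : Prop) => if x then a i else b i)]
  refine Finset.prod_congr rfl fun i _ => ?_
  rw [integral_add_measure (.smul_measure (integrable_dirac (by simp)) (by simp))
    (.smul_measure (integrable_dirac (by simp)) (by simp))]
  have h1 := integral_smul_nnreal_measure (μ := Measure.dirac (i ∈ u))
    (fun x : Prop => if x then a i else b i) (toNNReal p)
  have h2 := integral_smul_nnreal_measure (μ := Measure.dirac False)
    (fun x : Prop => if x then a i else b i) (toNNReal (σ p))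
  rw [h1, h2]
  simp only [integral_dirac, NNReal.smul_def, smul_eq_mul, coe_toNNReal, if_false, coe_symm_eq]
  split_ifs <;> ring

open Classical in
/-- The exponential moment of a Bernoulli set, on the event that it contains a given set. -/
theorem integral_setBernoulli_superset_le (u : Set ι) (p : I) (F : Finset ι) (b : ι → ℝ)
    (hb : ∀ i, 1 ≤ b i) :
    ∫ s, (if (F : Set ι) ⊆ s then (1 : ℝ) else 0) * ∏ i, (if i ∈ s then b i else 1)
        ∂(setBernoulli u p) ≤
      (∏ i ∈ F, (p : ℝ) * b i) * Real.exp (p * ∑ i, (b i - 1)) := by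
  have hp0 : (0 : ℝ) ≤ p := p.2.1
  have hp1 : (p : ℝ) ≤ 1 := p.2.2
  -- The indicator of `F ⊆ s` is itself a product over coordinates: a missing element of `F`
  -- contributes the factor `0`.
  have key : ∀ s : Set ι, (if (F : Set ι) ⊆ s then (1 : ℝ) else 0) *
      ∏ i, (if i ∈ s then b i else 1) =
      ∏ i, (if i ∈ s then b i else if i ∈ F then 0 else 1) := by
    intro s
    split_ifs with h
    · rw [one_mul]
      refine Finset.prod_congr rfl fun i _ => ?_
      by_cases hi : i ∈ s
      · simp [hi]
      · have : i ∉ F := fun hF => hi (h hF)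
        simp [hi, this]
    · obtain ⟨i, hi, his⟩ := Set.not_subset.1 h
      rw [zero_mul, eq_comm]
      refine Finset.prod_eq_zero (Finset.mem_univ i) ?_
      have : i ∈ F := hi
      simp [his, this]
  simp_rw [key]
  have hF : ∏ i ∈ F, (p : ℝ) * b i = ∏ i, if i ∈ F then (p : ℝ) * b i else 1 := by
    rw [Finset.prod_ite_mem, Finset.univ_inter]
  rw [integral_setBernoulli_prod, Finset.mul_sum, Real.exp_sum, hF, ← Finset.prod_mul_distrib]
  refine Finset.prod_le_prod (fun i _ => ?_) fun i _ => ?_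
  · have := hb i
    split_ifs <;> nlinarith
  · have hbi := hb i
    have h0 : 0 ≤ (p : ℝ) * (b i - 1) := mul_nonneg hp0 (by linarith)
    have h1 := Real.add_one_le_exp ((p : ℝ) * (b i - 1))
    by_cases hiF : i ∈ F
    · have h2 : (p : ℝ) * b i ≤ p * b i * Real.exp (p * (b i - 1)) :=
        le_mul_of_one_le_right (by nlinarith) (by linarith)
      by_cases hiu : i ∈ u
      · simpa [hiF, hiu] using h2
      · simp only [hiF, hiu, if_true, if_false]
        nlinarith
    · by_cases hiu : i ∈ u
      · simp only [hiF, hiu, if_true, if_false]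
        nlinarith
      · simp only [hiF, hiu, if_false]
        nlinarith

end Bernoulli

/-! ### Exponential moments of degree sums. -/

section Degrees

variable {V : Type*}

open Classical in
/-- The number of vertices of `S` incident with `e`. -/
noncomputable def incidenceCount (S : Finset V) (e : Sym2 V) : ℕ := (S.filter (· ∈ e)).card

theorem incidenceCount_le_two (S : Finset V) (e : Sym2 V) : incidenceCount S e ≤ 2 := by
  classical
  induction e with
  | h a b =>
    refine (Finset.card_le_card (t := {a, b}) fun x hx => ?_).trans Finset.card_le_two
    simpa using (Finset.mem_filter.1 hx).2

variable [Fintype V]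

open Classical in
theorem deg_eq_sum_edges (G : SimpleGraph V) (x : V) :
    deg G x = ∑ e : Sym2 V, if e ∈ G.edgeSet ∧ x ∈ e then 1 else 0 := by
  rw [deg, Finset.sum_boole, Set.ncard_eq_toFinset_card', Nat.cast_id]
  have h := G.card_incidenceFinset_eq_degree x
  rw [← SimpleGraph.card_neighborFinset_eq_degree] at h
  rw [← SimpleGraph.neighborFinset_def, ← h]
  congr 1
  ext e
  simp [SimpleGraph.mem_incidenceFinset, SimpleGraph.incidenceSet]

open Classical in
theorem sum_deg_eq_sum_incidenceCount (G : SimpleGraph V) (S : Finset V) :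
    ∑ x ∈ S, deg G x = ∑ e : Sym2 V, if e ∈ G.edgeSet then incidenceCount S e else 0 := by
  simp_rw [deg_eq_sum_edges]
  rw [Finset.sum_comm]
  refine Finset.sum_congr rfl fun e _ => ?_
  split_ifs with h
  · simp [h, incidenceCount]
  · simp [h]

theorem sum_incidenceCount (S : Finset V) :
    ∑ e : Sym2 V, incidenceCount S e = S.card * Fintype.card V := by
  classical
  simp_rw [incidenceCount, Finset.card_filter]
  rw [Finset.sum_comm]
  refine Finset.sum_const_nat fun x _ => ?_
  rw [Finset.sum_boole, Nat.cast_id]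
  rw [← Finset.card_univ]
  symm
  refine Finset.card_bij (fun y _ => s(x, y)) (by simp) (fun _ _ _ _ h => Sym2.congr_right.1 h) ?_
  intro e he
  obtain ⟨y, rfl⟩ := (Finset.mem_filter.1 he).2
  exact ⟨y, by simp⟩

theorem card_incidenceCount_eq_two (S : Finset V) :
    (Finset.univ.filter fun e : Sym2 V => incidenceCount S e = 2).card ≤ S.card * S.card := by
  classical
  rw [← Finset.card_product]
  refine (Finset.card_le_card (t := (S ×ˢ S).image fun x => s(x.1, x.2)) fun e he => ?_).trans
    Finset.card_image_le
  replace he := (Finset.mem_filter.1 he).2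
  induction e with
  | h a b =>
    have key : S.filter (· ∈ s(a, b)) = {a, b} := by
      refine Finset.eq_of_subset_of_card_le (fun x hx => ?_) ?_
      · simpa using (Finset.mem_filter.1 hx).2
      · rw [incidenceCount] at he
        rw [he]; exact Finset.card_le_two
    have ha : a ∈ S.filter (· ∈ s(a, b)) := by rw [key]; simp
    have hb : b ∈ S.filter (· ∈ s(a, b)) := by rw [key]; simp
    exact Finset.mem_image.2 ⟨(a, b), by simp [(Finset.mem_filter.1 ha).1,
      (Finset.mem_filter.1 hb).1], rfl⟩

/-- Since `e^{2l} - 1 = 2(e^l - 1) + (e^l - 1)^2`, the degrees behave as if independent, up to a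
square term for each pair inside `S`. -/
theorem sum_exp_incidenceCount_le (S : Finset V) (l : ℝ) :
    ∑ e : Sym2 V, (Real.exp (l * incidenceCount S e) - 1) ≤
      S.card * Fintype.card V * (Real.exp l - 1) + S.card ^ 2 * (Real.exp l - 1) ^ 2 := by
  classical
  have h1 : ∀ e : Sym2 V, Real.exp (l * incidenceCount S e) - 1 =
      incidenceCount S e * (Real.exp l - 1) +
        (if incidenceCount S e = 2 then 1 else 0) * (Real.exp l - 1) ^ 2 := by
    intro e
    have h2 := incidenceCount_le_two S e
    rw [mul_comm l, Real.exp_nat_mul]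
    interval_cases incidenceCount S e <;> norm_num
    ring
  simp_rw [h1]
  rw [Finset.sum_add_distrib, ← Finset.sum_mul, ← Finset.sum_mul, ← Nat.cast_sum,
    sum_incidenceCount, Finset.sum_boole]
  have h3 : ((Finset.univ.filter fun e : Sym2 V => incidenceCount S e = 2).card : ℝ) ≤
      (S.card : ℝ) ^ 2 := by
    rw [sq]; exact_mod_cast card_incidenceCount_eq_two S
  push_cast
  gcongr

/-- Makes every function on the finite outcome space measurable and integrable. -/
instance : MeasurableSingletonClass (SimpleGraph V) where
  measurableSet_singleton G := by
    have : {G} = SimpleGraph.edgeSet ⁻¹' {G.edgeSet} := by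
      ext H
      simp
    rw [this]
    exact SimpleGraph.measurable_edgeSet (measurableSet_singleton _)

open Classical in
/-- The joint exponential moment of the degrees of the vertices of `S` in a binomial random graph,
on the event that the edges of `F` are present. -/
theorem integral_binomialRandom_exp_deg_le (p : I) (S : Finset V) (F : Finset (Sym2 V)) {l : ℝ}
    (hl : 0 ≤ l) :
    ∫ G, (if (F : Set (Sym2 V)) ⊆ G.edgeSet then (1 : ℝ) else 0) *
        Real.exp (l * ∑ x ∈ S, deg G x) ∂(SimpleGraph.binomialRandom V p) ≤
      ((p : ℝ) * Real.exp (2 * l)) ^ F.card *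
        Real.exp (p * (S.card * Fintype.card V * (Real.exp l - 1) +
          S.card ^ 2 * (Real.exp l - 1) ^ 2)) := by
  have hp0 : (0 : ℝ) ≤ p := p.2.1
  set b : Sym2 V → ℝ := fun e => Real.exp (l * incidenceCount S e)
  have hb : ∀ e, 1 ≤ b e := fun e => Real.one_le_exp (by positivity)
  have h1 : ∀ G : SimpleGraph V, Real.exp (l * ∑ x ∈ S, deg G x) =
      ∏ e, if e ∈ G.edgeSet then b e else 1 := by
    intro G
    rw [sum_deg_eq_sum_incidenceCount, Nat.cast_sum, Finset.mul_sum, Real.exp_sum]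
    refine Finset.prod_congr rfl fun e _ => ?_
    split_ifs <;> simp [b]
  simp_rw [h1]
  have hmp : ∫ G, (if (F : Set (Sym2 V)) ⊆ G.edgeSet then (1 : ℝ) else 0) *
        ∏ e, (if e ∈ G.edgeSet then b e else 1) ∂(SimpleGraph.binomialRandom V p) ≤
      ∫ s, (if (F : Set (Sym2 V)) ⊆ s then (1 : ℝ) else 0) *
        ∏ e, (if e ∈ s then b e else 1) ∂(setBernoulli Sym2.diagSetᶜ p) := by
    rw [SimpleGraph.binomialRandom_eq_map, integral_map (by fun_prop)
      ((measurable_of_finite _).aestronglyMeasurable)]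
    refine (integral_congr_ae ?_).le
    -- Almost surely `s` has no loops, so `fromEdgeSet s` loses nothing.
    filter_upwards [setBernoulli_ae_subset] with s hs
    have : (SimpleGraph.fromEdgeSet s).edgeSet = s := by
      rw [SimpleGraph.edgeSet_fromEdgeSet]
      exact sdiff_eq_left.2 (Set.subset_compl_iff_disjoint_right.1 hs)
    simp only [this]
  refine hmp.trans ((integral_setBernoulli_superset_le _ p F b hb).trans ?_)
  refine mul_le_mul ?_ ?_ (Real.exp_pos _).le (by positivity)
  · rw [← Finset.prod_const]
    refine Finset.prod_le_prod (fun e _ => by positivity) fun e _ => ?_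
    have : (incidenceCount S e : ℝ) ≤ 2 := by exact_mod_cast incidenceCount_le_two S e
    refine mul_le_mul_of_nonneg_left (Real.exp_le_exp.2 ?_) hp0
    nlinarith
  · refine Real.exp_le_exp.2 (mul_le_mul_of_nonneg_left (sum_exp_incidenceCount_le S l) hp0)

open Classical in
/-- The exponential moment of `|T ∩ S| + χ |T|` for a Bernoulli set `T`, on the event `F ⊆ T`. -/
theorem integral_setBernoulli_exp_card_le (p : I) (S F : Finset V) (χ : ℕ) (hχ : χ ≤ 1) {l : ℝ}
    (hl : 0 ≤ l) :
    ∫ T, (if (F : Set V) ⊆ T then (1 : ℝ) else 0) *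
        Real.exp (l * ((∑ x ∈ S, if x ∈ T then 1 else 0) + χ * T.ncard))
        ∂(setBernoulli (Set.univ : Set V) p) ≤
      ((p : ℝ) * Real.exp (2 * l)) ^ F.card *
        Real.exp (p * (χ * Fintype.card V * (Real.exp l - 1) +
          S.card * (Real.exp l * (Real.exp l - 1)))) := by
  have hp0 : (0 : ℝ) ≤ p := p.2.1
  have hel : 1 ≤ Real.exp l := Real.one_le_exp hl
  set b : V → ℝ := fun y => Real.exp (l * ((if y ∈ S then 1 else 0) + χ))
  have hb : ∀ y, 1 ≤ b y := fun y => Real.one_le_exp (by positivity)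
  have hχ' : (χ : ℝ) ≤ 1 := by exact_mod_cast hχ
  have h1 : ∀ T : Set V, Real.exp (l * ((∑ x ∈ S, if x ∈ T then 1 else 0) + χ * T.ncard)) =
      ∏ y, if y ∈ T then b y else 1 := by
    intro T
    have h2 : (T.ncard : ℝ) = ∑ y, if y ∈ T then (1 : ℝ) else 0 := by
      rw [Finset.sum_boole, Set.ncard_eq_toFinset_card']
      congr 2; ext; simp
    have h3 : (∑ x ∈ S, if x ∈ T then (1 : ℝ) else 0) =
        ∑ y, if y ∈ S then (if y ∈ T then (1 : ℝ) else 0) else 0 := by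
      rw [Finset.sum_ite_mem, Finset.univ_inter]
    rw [h2, h3, Finset.mul_sum, ← Finset.sum_add_distrib, Finset.mul_sum, Real.exp_sum]
    refine Finset.prod_congr rfl fun y _ => ?_
    by_cases hT : y ∈ T <;> simp [b, hT]
  simp_rw [h1]
  refine (integral_setBernoulli_superset_le _ p F b hb).trans ?_
  refine mul_le_mul ?_ ?_ (Real.exp_pos _).le (by positivity)
  · rw [← Finset.prod_const]
    refine Finset.prod_le_prod (fun e _ => by positivity) fun e _ => ?_
    refine mul_le_mul_of_nonneg_left (Real.exp_le_exp.2 ?_) hp0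
    split_ifs <;> nlinarith
  · refine Real.exp_le_exp.2 (mul_le_mul_of_nonneg_left ?_ hp0)
    -- For `χ = 1` and `y ∈ S` this is the identity `e^{2l} - 1 = (e^l - 1) + e^l (e^l - 1)`.
    have h4 : ∀ y, b y - 1 ≤ χ * (Real.exp l - 1) +
        if y ∈ S then Real.exp l * (Real.exp l - 1) else 0 := by
      intro y
      simp only [b]
      have h5 : l * (1 + 1) = l + l := by ring
      interval_cases χ <;> split_ifs <;> simp [h5, Real.exp_add] <;> nlinarith
    refine (Finset.sum_le_sum fun y _ => h4 y).trans (le_of_eq ?_)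
    rw [Finset.sum_add_distrib, Finset.sum_ite_mem, Finset.univ_inter]
    simp
    ring

end Degrees

/-! ### Weighted paths in one random graph with an attached vertex. -/

section Attached

variable {V : Type*}

open Classical in
/-- The degree of the vertex `x` of `ω.1` once an extra vertex with neighbourhood `ω.2` is
attached. -/
noncomputable def attachedDeg (ω : SimpleGraph V × Set V) (x : V) : ℕ :=
  deg ω.1 x + if x ∈ ω.2 then 1 else 0

variable (V) in
/-- The law of a binomial random graph with a randomly attached extra vertex. -/
noncomputable def attachedLaw (p : I) : Measure (SimpleGraph V × Set V) :=
  (SimpleGraph.binomialRandom V p).prod (setBernoulli (Set.univ : Set V) p)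

/-- `f` lists the vertices of a path that starts at a neighbour of the extra vertex. -/
def IsAttachedPath (ω : SimpleGraph V × Set V) {k : ℕ} (f : Fin (k + 1) → V) : Prop :=
  Function.Injective f ∧ (∀ j : Fin k, ω.1.Adj (f j.castSucc) (f j.succ)) ∧ f 0 ∈ ω.2

/-- Two edges coinciding with reversed ends would force `a = b + 1` and `b = a + 1`. Distinctness
yields a full factor `p` for each edge. -/
theorem injective_pathEdges {k : ℕ} {f : Fin (k + 1) → V} (hf : Function.Injective f) :
    Function.Injective fun j : Fin k => s(f j.castSucc, f j.succ) := by
  intro a b hab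
  rcases Sym2.eq_iff.1 hab with ⟨h, _⟩ | ⟨h1, h2⟩
  · exact Fin.castSucc_injective _ (hf h)
  · have h3 := congrArg Fin.val (hf h1)
    have h4 := congrArg Fin.val (hf h2)
    simp at h3 h4
    omega

variable [Fintype V]

instance (p : I) : IsProbabilityMeasure (attachedLaw V p) := by
  unfold attachedLaw; infer_instance

open Classical in
/-- The event that the edges of `F` are present and the extra vertex is attached to all of `K`. -/
noncomputable def presence (F : Finset (Sym2 V)) (K : Finset V) (ω : SimpleGraph V × Set V) : ℝ :=
  (if (F : Set (Sym2 V)) ⊆ ω.1.edgeSet then 1 else 0) * (if (K : Set V) ⊆ ω.2 then 1 else 0)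

/-- The graph and the attached set are independent, so the integral factors. A prescribed edge costs
`p e^{2l}` because it raises at most two of the counted degrees. The dependence between degrees is
absorbed by the `+ 1` in the exponent, which is where `p (q + 2) ≤ 1` enters. -/
theorem integral_presence_exp_deg_le (p : I) (F : Finset (Sym2 V)) (K S : Finset V) (χ : ℕ)
    (hχ : χ ≤ 1) {l : ℝ} (hl : 0 ≤ l) (hl2 : Real.exp l ≤ 2) {q : ℝ} (hS : (S.card : ℝ) ≤ q)
    (hq : p * (q + 2) ≤ 1) :
    ∫ ω, presence F K ω * Real.exp (l * ((∑ x ∈ S, (attachedDeg ω x : ℝ)) + χ * ω.2.ncard))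
        ∂(attachedLaw V p) ≤
      ((p : ℝ) * Real.exp (2 * l)) ^ (F.card + K.card) *
        Real.exp ((p * Fintype.card V * (Real.exp l - 1) + 1) * (S.card + χ)) := by
  classical
  have hp0 : (0 : ℝ) ≤ p := p.2.1
  have hel : 1 ≤ Real.exp l := Real.one_le_exp hl
  have h1 : ∀ ω : SimpleGraph V × Set V, presence F K ω *
      Real.exp (l * ((∑ x ∈ S, (attachedDeg ω x : ℝ)) + χ * ω.2.ncard)) =
      ((if (F : Set (Sym2 V)) ⊆ ω.1.edgeSet then (1 : ℝ) else 0) *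
        Real.exp (l * ∑ x ∈ S, deg ω.1 x)) *
      ((if (K : Set V) ⊆ ω.2 then (1 : ℝ) else 0) *
        Real.exp (l * ((∑ x ∈ S, if x ∈ ω.2 then 1 else 0) + χ * ω.2.ncard))) := by
    intro ω
    simp only [presence, attachedDeg, Nat.cast_add, Finset.sum_add_distrib, Nat.cast_ite,
      Nat.cast_one, Nat.cast_zero, add_assoc]
    rw [mul_add l, Real.exp_add]
    push_cast
    ring
  simp_rw [h1]
  rw [attachedLaw, integral_prod_mul
    (fun G : SimpleGraph V => (if (F : Set (Sym2 V)) ⊆ G.edgeSet then (1 : ℝ) else 0) *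
        Real.exp (l * ∑ x ∈ S, deg G x))
    (fun T : Set V => (if (K : Set V) ⊆ T then (1 : ℝ) else 0) *
        Real.exp (l * ((∑ x ∈ S, if x ∈ T then 1 else 0) + χ * T.ncard)))]
  refine (mul_le_mul (integral_binomialRandom_exp_deg_le p S F hl)
    (integral_setBernoulli_exp_card_le p S K χ hχ hl)
    (integral_nonneg fun T => by positivity) (by positivity)).trans ?_
  rw [mul_mul_mul_comm, ← pow_add, ← Real.exp_add, ← mul_add]
  refine mul_le_mul_of_nonneg_left (Real.exp_le_exp.2 ?_) (by positivity)
  set s : ℝ := (S.card : ℝ)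
  set m : ℝ := (Fintype.card V : ℝ)
  set E : ℝ := Real.exp l - 1 with hE
  have hs0 : 0 ≤ s := by positivity
  have hχ0 : (0 : ℝ) ≤ χ := by positivity
  have hE0 : 0 ≤ E := by linarith
  have hE1 : E ≤ 1 := by linarith
  have h2 : s ^ 2 * E ^ 2 + s * (Real.exp l * E) ≤ s * (q + 2) := by
    have h3 : E ^ 2 ≤ 1 := by nlinarith
    have h4 : Real.exp l * E ≤ 2 := by nlinarith
    have h5 : s * E ^ 2 ≤ q := by nlinarith
    nlinarith
  have h6 : p * (s ^ 2 * E ^ 2 + s * (Real.exp l * E)) ≤ s := by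
    calc p * (s ^ 2 * E ^ 2 + s * (Real.exp l * E)) ≤ p * (s * (q + 2)) := by gcongr
      _ = s * (p * (q + 2)) := by ring
      _ ≤ s * 1 := by gcongr
      _ = s := mul_one s
  nlinarith

/-- The product of the factors `1 + A e^{l Δ(x)}` over `x ∈ X` and over the extra vertex, whose
degree is allowed to exceed the number of its attached neighbours by two. -/
noncomputable def degreeFactor (A l : ℝ) (X : Finset V) (ω : SimpleGraph V × Set V) : ℝ :=
  (1 + A * Real.exp (l * (ω.2.ncard + 2))) *
    ∏ x ∈ X, (1 + A * Real.exp (l * attachedDeg ω x))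

/-- Expanding the product gives `2^(|X|+1)` terms, one for each choice of counted vertices; in each
term the powers of `A` cancel the exponential moment by `hA1`. -/
theorem integral_presence_degreeFactor_le (p : I) (F : Finset (Sym2 V)) (K X : Finset V)
    {l A : ℝ} (hl : 0 ≤ l) (hl2 : Real.exp l ≤ 2) (hA : 0 ≤ A)
    (hA1 : A * Real.exp (p * Fintype.card V * (Real.exp l - 1) + 1 + 2 * l) ≤ 1)
    {q : ℝ} (hX : (X.card : ℝ) ≤ q) (hq : p * (q + 2) ≤ 1) :
    ∫ ω, presence F K ω * degreeFactor A l X ω ∂(attachedLaw V p) ≤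
      ((p : ℝ) * Real.exp (2 * l)) ^ (F.card + K.card) * 2 ^ (X.card + 1) := by
  classical
  have hp0 : (0 : ℝ) ≤ p := p.2.1
  have h1 : ∀ ω : SimpleGraph V × Set V, presence F K ω * degreeFactor A l X ω =
      ∑ χ ∈ Finset.range 2, ∑ S ∈ X.powerset, (A ^ (S.card + χ) * Real.exp (2 * l) ^ χ) *
        (presence F K ω *
          Real.exp (l * ((∑ x ∈ S, (attachedDeg ω x : ℝ)) + χ * ω.2.ncard))) := by
    intro ω
    rw [degreeFactor, Finset.prod_one_add, Finset.sum_range_succ, Finset.sum_range_one, add_mul,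
      one_mul, mul_add, Finset.mul_sum, Finset.mul_sum, Finset.mul_sum]
    congr 1
    · refine Finset.sum_congr rfl fun S _ => ?_
      rw [Finset.prod_mul_distrib, Finset.prod_const, ← Real.exp_sum, ← Finset.mul_sum]
      simp
      ring
    · refine Finset.sum_congr rfl fun S _ => ?_
      rw [Finset.prod_mul_distrib, Finset.prod_const, ← Real.exp_sum, ← Finset.mul_sum]
      rw [mul_add l, mul_add l, Real.exp_add, Real.exp_add, pow_succ, Nat.cast_one, one_mul,
        pow_one, mul_comm l 2]
      ring
  simp_rw [h1]
  rw [integral_finsetSum _ fun _ _ => .of_finite]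
  have h2 : ∀ χ ∈ Finset.range 2, ∀ S ∈ X.powerset,
      ∫ ω, (A ^ (S.card + χ) * Real.exp (2 * l) ^ χ) * (presence F K ω *
          Real.exp (l * ((∑ x ∈ S, (attachedDeg ω x : ℝ)) + χ * ω.2.ncard))) ∂(attachedLaw V p) ≤
      ((p : ℝ) * Real.exp (2 * l)) ^ (F.card + K.card) := by
    intro χ hχ S hS
    have hχ1 : χ ≤ 1 := by have := Finset.mem_range.1 hχ; omega
    have hSq : (S.card : ℝ) ≤ q :=
      le_trans (by exact_mod_cast Finset.card_le_card (Finset.mem_powerset.1 hS)) hX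
    rw [integral_const_mul]
    refine (mul_le_mul_of_nonneg_left
      (integral_presence_exp_deg_le p F K S χ hχ1 hl hl2 hSq hq) (by positivity)).trans ?_
    rw [mul_left_comm]
    refine mul_le_of_le_one_right (by positivity) ?_
    have h3 : Real.exp ((p * Fintype.card V * (Real.exp l - 1) + 1) * (S.card + χ)) =
        Real.exp (p * Fintype.card V * (Real.exp l - 1) + 1) ^ (S.card + χ) := by
      rw [← Real.exp_nat_mul]
      push_cast
      ring_nf
    -- Enlarging this exponent turns the whole term into a power of the single quantity bounded in
    -- `hA1`.
    have h4 : Real.exp (2 * l) ^ χ ≤ Real.exp (2 * l) ^ (S.card + χ) :=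
      pow_le_pow_right₀ (Real.one_le_exp (by positivity)) (by omega)
    calc A ^ (S.card + χ) * Real.exp (2 * l) ^ χ *
          Real.exp ((p * Fintype.card V * (Real.exp l - 1) + 1) * (S.card + χ))
        ≤ A ^ (S.card + χ) * Real.exp (2 * l) ^ (S.card + χ) *
          Real.exp (p * Fintype.card V * (Real.exp l - 1) + 1) ^ (S.card + χ) := by
          rw [h3]; gcongr
      _ = (A * Real.exp (p * Fintype.card V * (Real.exp l - 1) + 1 + 2 * l)) ^ (S.card + χ) := by
          rw [Real.exp_add _ (2 * l), mul_pow, mul_pow]; ring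
      _ ≤ 1 := pow_le_one₀ (by positivity) hA1
  calc ∑ χ ∈ Finset.range 2, ∫ ω, ∑ S ∈ X.powerset, (A ^ (S.card + χ) * Real.exp (2 * l) ^ χ) *
        (presence F K ω *
          Real.exp (l * ((∑ x ∈ S, (attachedDeg ω x : ℝ)) + χ * ω.2.ncard))) ∂(attachedLaw V p)
      ≤ ∑ χ ∈ Finset.range 2, ∑ S ∈ X.powerset,
          ((p : ℝ) * Real.exp (2 * l)) ^ (F.card + K.card) := by
        refine Finset.sum_le_sum fun χ hχ => ?_
        rw [integral_finsetSum _ fun _ _ => .of_finite]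
        exact Finset.sum_le_sum fun S hS => h2 χ hχ S hS
    _ = _ := by
        simp [Finset.card_powerset, pow_succ]
        ring

open Classical in
/-- The sum of `∏ ρ (1 + A e^{l Δ(x)})` over the paths with at most `L` edges that start at a
neighbour of the extra vertex. -/
noncomputable def attachedPathSum (L : ℕ) (A l ρ : ℝ) (ω : SimpleGraph V × Set V) : ℝ :=
  ∑ k ∈ Finset.range (L + 1), ∑ f : Fin (k + 1) → V,
    if IsAttachedPath ω f then ∏ j, (ρ * (1 + A * Real.exp (l * attachedDeg ω (f j)))) else 0

open Classical in
-- The `k` path edges and the attaching edge at `f 0` give `k + 1` factors `p e^{2l}`, one per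
-- vertex of the path.
theorem integral_degreeFactor_path_le (p : I) {l A ρ : ℝ} (hl : 0 ≤ l) (hl2 : Real.exp l ≤ 2)
    (hA : 0 ≤ A) (hρ : 0 ≤ ρ)
    (hA1 : A * Real.exp (p * Fintype.card V * (Real.exp l - 1) + 1 + 2 * l) ≤ 1)
    {q : ℝ} {k : ℕ} (hk : (k : ℝ) + 1 ≤ q) (hq : p * (q + 2) ≤ 1) (f : Fin (k + 1) → V) :
    ∫ ω, (1 + A * Real.exp (l * (ω.2.ncard + 2))) * (if IsAttachedPath ω f then
        ∏ j, (ρ * (1 + A * Real.exp (l * attachedDeg ω (f j)))) else 0) ∂(attachedLaw V p) ≤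
      2 * (2 * (ρ * (p * Real.exp (2 * l)))) ^ (k + 1) := by
  have hp0 : (0 : ℝ) ≤ p := p.2.1
  by_cases hf : Function.Injective f
  · set F : Finset (Sym2 V) := Finset.univ.image fun j : Fin k => s(f j.castSucc, f j.succ) with hF
    set X : Finset V := Finset.univ.image f with hX
    have hFc : F.card = k := by
      rw [hF, Finset.card_image_of_injective _ (injective_pathEdges hf), Finset.card_fin]
    have hXc : X.card = k + 1 := by
      rw [hX, Finset.card_image_of_injective _ hf, Finset.card_fin]
    have h1 : ∀ ω : SimpleGraph V × Set V,
        (1 + A * Real.exp (l * (ω.2.ncard + 2))) * (if IsAttachedPath ω f then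
          ∏ j, (ρ * (1 + A * Real.exp (l * attachedDeg ω (f j)))) else 0) =
        ρ ^ (k + 1) * (presence F {f 0} ω * degreeFactor A l X ω) := by
      intro ω
      have h2 : (F : Set (Sym2 V)) ⊆ ω.1.edgeSet ↔
          ∀ j : Fin k, ω.1.Adj (f j.castSucc) (f j.succ) := by
        simp [hF, Set.range_subset_iff]
      have h3 : ∏ x ∈ X, (1 + A * Real.exp (l * attachedDeg ω x)) =
          ∏ j, (1 + A * Real.exp (l * attachedDeg ω (f j))) := by
        rw [hX, Finset.prod_image fun a _ b _ h => hf h]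
      rw [presence, degreeFactor, h3, Finset.prod_mul_distrib, Finset.prod_const, Finset.card_fin]
      by_cases ha : ∀ j : Fin k, ω.1.Adj (f j.castSucc) (f j.succ)
      · by_cases hb : f 0 ∈ ω.2
        · rw [if_pos (c := IsAttachedPath ω f) ⟨hf, ha, hb⟩, if_pos (h2.2 ha), if_pos (by simpa)]
          ring
        · rw [if_neg (c := IsAttachedPath ω f) fun h => hb h.2.2,
            if_neg (c := ((({f 0} : Finset V) : Set V) ⊆ ω.2)) (by simpa)]
          ring
      · rw [if_neg (c := IsAttachedPath ω f) fun h => ha h.2.1, if_neg fun h => ha (h2.1 h)]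
        ring
    simp_rw [h1]
    rw [integral_const_mul]
    refine (mul_le_mul_of_nonneg_left (integral_presence_degreeFactor_le p F {f 0} X hl hl2 hA hA1
      (by rw [hXc]; exact_mod_cast hk) hq) (by positivity)).trans (le_of_eq ?_)
    rw [hFc, hXc, Finset.card_singleton, mul_pow, mul_pow, mul_pow]
    ring
  · have h1 : ∀ ω : SimpleGraph V × Set V, ¬ IsAttachedPath ω f := fun ω h => hf h.1
    simp only [h1, if_false, mul_zero, integral_zero]
    positivity

/-- The bound is `2 + 1`: `2` from the extra vertex alone, and less than `1` from the geometric
series over path lengths. -/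
theorem integral_degreeFactor_attachedPathSum_le (p : I) (L : ℕ) {l A ρ : ℝ} (hl : 0 ≤ l)
    (hl2 : Real.exp l ≤ 2) (hA : 0 ≤ A) (hρ : 0 ≤ ρ)
    (hA1 : A * Real.exp (p * Fintype.card V * (Real.exp l - 1) + 1 + 2 * l) ≤ 1)
    (hL : p * ((L : ℝ) + 3) ≤ 1)
    (hr : 2 * (ρ * (p * Real.exp (2 * l))) * Fintype.card V ≤ 1 / 3) :
    ∫ ω, (1 + A * Real.exp (l * (ω.2.ncard + 2))) * (1 + attachedPathSum L A l ρ ω)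
      ∂(attachedLaw V p) ≤ 3 := by
  classical
  have hp0 : (0 : ℝ) ≤ p := p.2.1
  set r : ℝ := 2 * (ρ * (p * Real.exp (2 * l))) with hrdef
  have hr0 : 0 ≤ r := by positivity
  have hq : (p : ℝ) * (((L : ℝ) + 1) + 2) ≤ 1 := by linarith
  have h0 : ∫ ω, (1 + A * Real.exp (l * (ω.2.ncard + 2))) ∂(attachedLaw V p) ≤ 2 := by
    have := integral_presence_degreeFactor_le p ∅ (∅ : Finset V) ∅ hl hl2 hA hA1
      (q := (L : ℝ) + 1) (by simp; positivity) hq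
    simpa [presence, degreeFactor] using this
  simp_rw [mul_add, mul_one, attachedPathSum, Finset.mul_sum]
  rw [integral_add .of_finite .of_finite, integral_finsetSum _ fun _ _ => .of_finite]
  have h1 : ∀ k ∈ Finset.range (L + 1), ∫ ω, ∑ f : Fin (k + 1) → V,
      (1 + A * Real.exp (l * (ω.2.ncard + 2))) * (if IsAttachedPath ω f then
        ∏ j, (ρ * (1 + A * Real.exp (l * attachedDeg ω (f j)))) else 0) ∂(attachedLaw V p) ≤
      2 * (1 / 3) ^ (k + 1) := by
    intro k hk
    rw [integral_finsetSum _ fun _ _ => .of_finite]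
    have hk' : (k : ℝ) + 1 ≤ (L : ℝ) + 1 := by exact_mod_cast Finset.mem_range.1 hk
    refine (Finset.sum_le_sum fun f _ =>
      integral_degreeFactor_path_le p hl hl2 hA hρ hA1 hk' hq f).trans ?_
    rw [Finset.sum_const, Finset.card_univ, Fintype.card_fun, Fintype.card_fin, nsmul_eq_mul,
      Nat.cast_pow, mul_left_comm, ← mul_pow, mul_comm _ r]
    gcongr
  have h2 : ∀ K : ℕ, ∑ k ∈ Finset.range K, (2 : ℝ) * (1 / 3) ^ (k + 1) = 1 - (1 / 3) ^ K := by
    intro K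
    induction K with
    | zero => simp
    | succ K ih => rw [Finset.sum_range_succ, ih]; ring
  have h3 := (Finset.sum_le_sum h1).trans_eq (h2 (L + 1))
  have h4 : (0 : ℝ) ≤ (1 / 3) ^ (L + 1) := by positivity
  simp only [mul_add, mul_one] at h0 h3 ⊢
  linarith

end Attached

/-! ### Deterministic bounds on weights and influences. -/

section Pointwise

theorem prod_map_support_eq_prod_range {V : Type*} {G : SimpleGraph V} (w : V → ℝ) {x y : V}
    (M : G.Walk x y) :
    (M.support.map w).prod = ∏ j ∈ Finset.range (M.length + 1), w (M.getVert j) := by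
  induction M with
  | nil => simp
  | cons h M ih =>
    rw [SimpleGraph.Walk.support_cons, List.map_cons, List.prod_cons, ih,
      SimpleGraph.Walk.length_cons, Finset.prod_range_succ' _ (M.length + 1), mul_comm]
    simp

variable {N m : ℕ}

theorem deg_graph_some_le (ω : Outcome N m) (i : Fin N) (a : Fin m) :
    deg (graph ω) (i, some a) ≤ attachedDeg (ω i) a := by
  classical
  have hsub : (graph ω).neighborSet (i, some a) ⊆
      (fun b => (i, some b)) '' (ω i).1.neighborSet a ∪
        (if a ∈ (ω i).2 then {(i, none)} else ∅) := by
    rintro ⟨j, _ | b⟩ h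
    · obtain ⟨rfl, h⟩ : i = j ∧ a ∈ (ω j).2 := h
      right
      simp [h]
    · obtain ⟨rfl, h⟩ : i = j ∧ (ω i).1.Adj a b := h
      left
      exact ⟨b, h, rfl⟩
  refine (Set.ncard_le_ncard hsub).trans ((Set.ncard_union_le _ _).trans ?_)
  refine add_le_add (Set.ncard_image_le (Set.toFinite _)) ?_
  split_ifs <;> simp

/-- The `+ 2` allows for the predecessor and successor on the path. -/
theorem deg_graph_none_le (ω : Outcome N m) (i : Fin N) :
    deg (graph ω) (i, none) ≤ (ω i).2.ncard + 2 := by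
  have hsub : (graph ω).neighborSet (i, none) ⊆
      (fun b => (i, some b)) '' (ω i).2 ∪
        ((fun j => (j, none)) '' {j : Fin N | i.val + 1 = j.val} ∪
          (fun j => (j, none)) '' {j : Fin N | j.val + 1 = i.val}) := by
    rintro ⟨j, _ | b⟩ h
    · right
      rcases (h : i.val + 1 = j.val ∨ j.val + 1 = i.val) with h | h
      · exact Or.inl ⟨j, h, rfl⟩
      · exact Or.inr ⟨j, h, rfl⟩
    · obtain ⟨rfl, h⟩ : i = j ∧ b ∈ (ω i).2 := h
      left
      exact ⟨b, h, rfl⟩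
  have h1 : ({j : Fin N | i.val + 1 = j.val}).ncard ≤ 1 :=
    (Set.ncard_le_one (Set.toFinite _)).2 fun a ha b hb =>
      Fin.ext ((Eq.symm ha).trans hb)
  have h2 : ({j : Fin N | j.val + 1 = i.val}).ncard ≤ 1 :=
    (Set.ncard_le_one (Set.toFinite _)).2 fun a ha b hb => by
      have ha' : a.val + 1 = i.val := ha
      have hb' : b.val + 1 = i.val := hb
      exact Fin.ext (by omega)
  refine (Set.ncard_le_ncard hsub).trans ((Set.ncard_union_le _ _).trans ?_)
  refine add_le_add (Set.ncard_image_le (Set.toFinite _)) ?_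
  refine (Set.ncard_union_le _ _).trans ?_
  have h3 := Set.ncard_image_le (f := fun j : Fin N => ((j, none) : Fin N × Option (Fin m)))
    (Set.toFinite {j : Fin N | i.val + 1 = j.val})
  have h4 := Set.ncard_image_le (f := fun j : Fin N => ((j, none) : Fin N × Option (Fin m)))
    (Set.toFinite {j : Fin N | j.val + 1 = i.val})
  omega

section Weights

variable {V : Type*} {d α γ c t A l : ℝ}

theorem vertexWeight_nonneg (G : SimpleGraph V) (hd : 0 ≤ d) (hγ : 0 < γ) (v : V) :
    0 ≤ vertexWeight G d α γ c v := by
  rw [vertexWeight]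
  split_ifs <;> positivity

/-- Replaces the threshold weight by an expression monotone in the degree, so that upper bounds `D`
on degrees suffice. -/
theorem vertexWeight_rpow_le (G : SimpleGraph V) (hd : 0 < d) (hγ : 0 < γ)
    (hA : 0 ≤ A) (hl : 0 ≤ l)
    (h : ∀ x : ℝ, (1 + α) * d < x → (d ^ c * x * (1 + γ)) ^ t ≤ A * Real.exp (l * x))
    {v : V} {D : ℝ} (hD : (deg G v : ℝ) ≤ D) :
    vertexWeight G d α γ c v ^ t ≤ (1 + γ) ^ (-t) * (1 + A * Real.exp (l * D)) := by
  have hg : (0 : ℝ) < 1 + γ := by linarith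
  have h1 : A * Real.exp (l * deg G v) ≤ A * Real.exp (l * D) := by gcongr
  rw [vertexWeight]
  split_ifs with hv
  · rw [Real.inv_rpow hg.le, ← Real.rpow_neg hg.le]
    refine le_mul_of_one_le_right (by positivity) ?_
    have : 0 ≤ A * Real.exp (l * D) := by positivity
    linarith
  · have h2 := h _ (not_le.1 hv)
    rw [Real.mul_rpow (by positivity) hg.le] at h2
    rw [Real.rpow_neg hg.le, inv_mul_eq_div, le_div_iff₀ (by positivity)]
    linarith

theorem augmentedWeight_eq (G : SimpleGraph V) (L : Set V) (ℓ : ℝ) (v : V) :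
    augmentedWeight G L ℓ d α γ c v =
      max 1 (maxOutsideInfluence G L ℓ d α γ c v) * vertexWeight G d α γ c v := by
  rw [augmentedWeight, vertexWeight]
  split_ifs
  · rw [div_eq_mul_inv]
  · rw [mul_assoc]

end Weights

/-- A path of the graph outside the pseudo-elementary path stays in a single `G_i`. -/
theorem exists_getVert_eq_some (ω : Outcome N m) {i : Fin N} {a : Fin m}
    {x : Fin N × Option (Fin m)} (M : (graph ω).Walk (i, some a) x)
    (hM : ∀ y ∈ M.support, y ∉ pathVertices N m) (j : ℕ) (hj : j ≤ M.length) :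
    ∃ b, M.getVert j = (i, some b) := by
  induction j with
  | zero => exact ⟨a, M.getVert_zero⟩
  | succ j ih =>
    obtain ⟨b, hb⟩ := ih (by omega)
    have h1 := M.adj_getVert_succ (i := j) (by omega)
    have h2 := hM _ (M.getVert_mem_support (j + 1))
    rw [hb] at h1
    rcases h : M.getVert (j + 1) with ⟨i', _ | b'⟩
    · rw [h] at h2
      exact absurd rfl h2
    · rw [h] at h1
      obtain ⟨rfl, -⟩ : i = i' ∧ (ω i).1.Adj b b' := h1
      exact ⟨b', rfl⟩

section Influence

variable {d α γ c t A l : ℝ}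

theorem attachedPathSum_nonneg {V : Type*} [Fintype V] (L : ℕ) {ρ : ℝ} (hA : 0 ≤ A) (hρ : 0 ≤ ρ)
    (ω : SimpleGraph V × Set V) : 0 ≤ attachedPathSum L A l ρ ω := by
  refine Finset.sum_nonneg fun k _ => Finset.sum_nonneg fun f _ => ?_
  split_ifs
  · exact Finset.prod_nonneg fun j _ => by positivity
  · exact le_rfl

/-- The path stays in `G_i`, so its vertices index one summand of `attachedPathSum`; the other
summands are nonnegative. -/
theorem outsidePathWeights_rpow_le (ω : Outcome N m) {ℓ : ℝ} (hd : 0 < d)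
    (hγ : 0 < γ) (hA : 0 ≤ A) (hl : 0 ≤ l)
    (h : ∀ x : ℝ, (1 + α) * d < x → (d ^ c * x * (1 + γ)) ^ t ≤ A * Real.exp (l * x))
    {i : Fin N} {a : Fin m} (ha : a ∈ (ω i).2) {r : ℝ}
    (hr : r ∈ outsidePathWeights (graph ω) (pathVertices N m) ℓ d α γ c (i, some a)) :
    0 ≤ r ∧ r ^ t ≤ attachedPathSum ⌊ℓ⌋₊ A l ((1 + γ) ^ (-t)) (ω i) := by
  classical
  obtain ⟨x, M, hM, hlen, hout, rfl⟩ := hr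
  have hw0 := fun v => vertexWeight_nonneg (α := α) (c := c) (graph ω) hd.le hγ v
  have hρ : 0 ≤ (1 + γ) ^ (-t) := by positivity
  refine ⟨List.prod_nonneg fun y hy => ?_, ?_⟩
  · obtain ⟨v, -, rfl⟩ := List.mem_map.1 hy
    exact hw0 v
  choose f hf using fun j : Fin (M.length + 1) =>
    exists_getVert_eq_some ω M hout j.val (Nat.lt_succ_iff.1 j.2)
  have hpath : IsAttachedPath (ω i) f := by
    refine ⟨fun j j' hjj => ?_, fun j => ?_, ?_⟩
    · refine Fin.ext (hM.getVert_injOn (Nat.lt_succ_iff.1 j.2) (Nat.lt_succ_iff.1 j'.2) ?_)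
      rw [hf, hf, hjj]
    · have h1 := M.adj_getVert_succ (i := j.val) j.2
      have h2 := hf j.castSucc
      have h3 := hf j.succ
      rw [Fin.val_castSucc] at h2
      rw [Fin.val_succ] at h3
      rw [h2, h3] at h1
      exact h1.2
    · have h1 := hf 0
      rw [Fin.val_zero, M.getVert_zero] at h1
      have h2 : a = f 0 := by simpa using h1
      rwa [← h2]
  rw [prod_map_support_eq_prod_range, Finset.prod_range,
    ← Real.finsetProd_rpow _ _ fun j _ => hw0 _]
  calc ∏ j : Fin (M.length + 1), vertexWeight (graph ω) d α γ c (M.getVert j) ^ t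
      ≤ ∏ j, ((1 + γ) ^ (-t) * (1 + A * Real.exp (l * attachedDeg (ω i) (f j)))) := by
        refine Finset.prod_le_prod (fun j _ => Real.rpow_nonneg (hw0 _) _) fun j _ => ?_
        refine vertexWeight_rpow_le _ hd hγ hA hl h ?_
        rw [hf j]
        exact_mod_cast deg_graph_some_le ω i (f j)
    _ = if IsAttachedPath (ω i) f then
          ∏ j, ((1 + γ) ^ (-t) * (1 + A * Real.exp (l * attachedDeg (ω i) (f j)))) else 0 := by
        rw [if_pos hpath]
    _ ≤ ∑ g : Fin (M.length + 1) → Fin m, if IsAttachedPath (ω i) g then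
          ∏ j, ((1 + γ) ^ (-t) * (1 + A * Real.exp (l * attachedDeg (ω i) (g j)))) else 0 := by
        refine Finset.single_le_sum (f := fun g : Fin (M.length + 1) → Fin m =>
          if IsAttachedPath (ω i) g then
          ∏ j, ((1 + γ) ^ (-t) * (1 + A * Real.exp (l * attachedDeg (ω i) (g j)))) else 0)
          (fun g _ => ?_) (Finset.mem_univ f)
        split_ifs
        · exact Finset.prod_nonneg fun j _ => by positivity
        · exact le_rfl
    _ ≤ _ := by
        refine Finset.single_le_sum (f := fun k => ∑ g : Fin (k + 1) → Fin m,
          if IsAttachedPath (ω i) g then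
          ∏ j, ((1 + γ) ^ (-t) * (1 + A * Real.exp (l * attachedDeg (ω i) (g j)))) else 0)
          (fun k _ => Finset.sum_nonneg fun g _ => ?_)
          (Finset.mem_range.2 (Nat.lt_succ_iff.2 (Nat.le_floor hlen)))
        split_ifs
        · exact Finset.prod_nonneg fun j _ => by positivity
        · exact le_rfl

theorem augmentedWeight_rpow_le (ω : Outcome N m) {ℓ : ℝ} (hd : 0 < d)
    (hγ : 0 < γ) (ht : 0 < t) (hA : 0 ≤ A) (hl : 0 ≤ l)
    (h : ∀ x : ℝ, (1 + α) * d < x → (d ^ c * x * (1 + γ)) ^ t ≤ A * Real.exp (l * x))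
    (i : Fin N) :
    augmentedWeight (graph ω) (pathVertices N m) ℓ d α γ c (i, none) ^ t ≤
      (1 + γ) ^ (-t) * ((1 + A * Real.exp (l * ((ω i).2.ncard + 2))) *
        (1 + attachedPathSum ⌊ℓ⌋₊ A l ((1 + γ) ^ (-t)) (ω i))) := by
  have hρ : 0 ≤ (1 + γ) ^ (-t) := by positivity
  set R := attachedPathSum ⌊ℓ⌋₊ A l ((1 + γ) ^ (-t)) (ω i) with hR
  have hR0 : 0 ≤ R := attachedPathSum_nonneg _ hA hρ _
  set Q := maxOutsideInfluence (graph ω) (pathVertices N m) ℓ d α γ c (i, none) with hQ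
  have hQle : Q ≤ (1 + R) ^ t⁻¹ := by
    -- Nonnegativity of the bound covers an empty set, whose `sSup` is `0`.
    refine Real.sSup_le ?_ (by positivity)
    rintro _ ⟨⟨j, _ | a⟩, ⟨hadj, hj⟩, rfl⟩
    · exact absurd rfl hj
    obtain ⟨rfl, ha⟩ : i = j ∧ a ∈ (ω i).2 := hadj
    refine Real.sSup_le (fun r hr => ?_) (by positivity)
    obtain ⟨hr0, hr1⟩ := outsidePathWeights_rpow_le ω hd hγ hA hl h ha hr
    rw [Real.le_rpow_inv_iff_of_pos hr0 (by positivity) ht]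
    linarith
  have hmax : max 1 Q ^ t ≤ 1 + R := by
    rw [← Real.le_rpow_inv_iff_of_pos (by positivity) (by positivity) ht]
    exact max_le (Real.one_le_rpow (by linarith) (by positivity)) hQle
  rw [augmentedWeight_eq, Real.mul_rpow (by positivity) (vertexWeight_nonneg _ hd.le hγ _)]
  have hw := vertexWeight_rpow_le (c := c) (graph ω) (v := (i, none))
    (D := (ω i).2.ncard + 2) hd hγ hA hl h
    (by exact_mod_cast deg_graph_none_le ω i)
  calc max 1 Q ^ t * vertexWeight (graph ω) d α γ c (i, none) ^ t
      ≤ (1 + R) * ((1 + γ) ^ (-t) * (1 + A * Real.exp (l * ((ω i).2.ncard + 2)))) :=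
        mul_le_mul hmax hw (Real.rpow_nonneg (vertexWeight_nonneg _ hd.le hγ _) _) (by positivity)
    _ = _ := by ring

end Influence

end Pointwise

/-! ### The moment bound and Markov's inequality. -/

section Tail

variable {N : ℕ} {d α γ c t A l δ : ℝ}

/-- Markov's inequality for the `t`-th moment of `AC`. -/
theorem law_real_le_AC (n : ℕ) (p : I) (hd : 0 < d) (hγ : 0 < γ) (ht : 0 < t)
    (hA : 0 ≤ A) (hl : 0 ≤ l) (hl2 : Real.exp l ≤ 2) (hδ : 0 < δ)
    (h : ∀ x : ℝ, (1 + α) * d < x → (d ^ c * x * (1 + γ)) ^ t ≤ A * Real.exp (l * x))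
    (hA1 : A * Real.exp (p * ((n - 1 : ℕ) : ℝ) * (Real.exp l - 1) + 1 + 2 * l) ≤ 1)
    (hL : p * ((⌊Real.log n / d ^ (2 / 5 : ℝ)⌋₊ : ℝ) + 3) ≤ 1)
    (hr : 2 * ((1 + γ) ^ (-t) * (p * Real.exp (2 * l))) * ((n - 1 : ℕ) : ℝ) ≤ 1 / 3) :
    (law N (n - 1) p).real {ω | δ ≤ AC n d α γ c ω} ≤
      3 ^ N * ((1 + γ) ^ (-t)) ^ N * δ ^ (-t) := by
  have hg : (0 : ℝ) < 1 + γ := by linarith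
  set ρ : ℝ := (1 + γ) ^ (-t) with hρdef
  have hρ : 0 < ρ := by positivity
  set K : ℕ := ⌊Real.log n / d ^ (2 / 5 : ℝ)⌋₊
  let g : SimpleGraph (Fin (n - 1)) × Set (Fin (n - 1)) → ℝ := fun η =>
    (1 + A * Real.exp (l * (η.2.ncard + 2))) * (1 + attachedPathSum K A l ρ η)
  have hg0 : ∀ η, 0 ≤ g η := fun η => by
    have := attachedPathSum_nonneg (l := l) K hA hρ.le η
    positivity
  have hlaw : law N (n - 1) p = Measure.pi fun _ : Fin N => attachedLaw (Fin (n - 1)) p := rfl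
  have : IsProbabilityMeasure (law N (n - 1) p) := by rw [hlaw]; infer_instance
  have hint : ∫ ω, ∏ i, (ρ * g (ω i)) ∂(law N (n - 1) p) ≤ (3 * ρ) ^ N := by
    -- Each factor depends on its own block only, so independence factors the mean.
    rw [hlaw, integral_fintype_prod_eq_prod (𝕜 := ℝ) (fun (_ : Fin N) η => ρ * g η)]
    refine (Finset.prod_le_prod (g := fun _ => 3 * ρ)
      (fun i _ => integral_nonneg fun η => mul_nonneg hρ.le (hg0 η)) fun i _ => ?_).trans_eq
      (by simp)
    rw [integral_const_mul, mul_comm]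
    exact mul_le_mul_of_nonneg_right (integral_degreeFactor_attachedPathSum_le p K hl hl2 hA hρ.le
      (by simpa using hA1) hL (by simpa using hr)) hρ.le
  have hsub : {ω | δ ≤ AC n d α γ c ω} ⊆
      {ω : Outcome N (n - 1) | δ ^ t ≤ ∏ i, (ρ * g (ω i))} := by
    intro ω (hω : δ ≤ AC n d α γ c ω)
    have hU0 : ∀ i : Fin N, 0 ≤ augmentedWeight (graph ω) (pathVertices N (n - 1))
        (Real.log n / d ^ (2 / 5 : ℝ)) d α γ c (i, none) := fun i => by
      rw [augmentedWeight_eq]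
      exact mul_nonneg (by positivity) (vertexWeight_nonneg _ hd.le hγ _)
    refine (Real.rpow_le_rpow hδ.le hω ht.le).trans ?_
    rw [AC, ← Real.finsetProd_rpow _ _ fun i _ => hU0 i]
    exact Finset.prod_le_prod (fun i _ => Real.rpow_nonneg (hU0 i) _) fun i _ =>
      augmentedWeight_rpow_le ω hd hγ ht hA hl h i
  have hmarkov := mul_meas_ge_le_integral_of_nonneg (μ := law N (n - 1) p)
    (f := fun ω => ∏ i, (ρ * g (ω i)))
    (ae_of_all _ fun ω => Finset.prod_nonneg fun i _ => mul_nonneg hρ.le (hg0 _)) .of_finite (δ ^ t)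
  have h1 := (mul_le_mul_of_nonneg_left (measureReal_mono (μ := law N (n - 1) p) hsub)
    (Real.rpow_nonneg hδ.le t)).trans (hmarkov.trans hint)
  rw [Real.rpow_neg hδ.le, ← div_eq_mul_inv, le_div_iff₀ (by positivity), mul_comm, ← mul_pow]
  exact h1

end Tail

/-! ### Choice of the moment order. -/

section Parameters

/-- Here `24 d ≤ e^(4+y) ≤ e^(3y)`. The constant `24` is what a geometric ratio `8 d (1+γ)^(-t) ≤
1/3` requires. -/
theorem mul_le_rpow {γ d y K : ℝ} (hγ : 0 < γ) (hd : 0 < d) (hy : 2 ≤ y) (hdy : Real.log d ≤ y)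
    (hK : 3 ≤ K * Real.log (1 + γ)) : 24 * d ≤ (1 + γ) ^ (K * y) := by
  have h5 : (5 : ℝ) ≤ Real.exp 2 := by
    linarith [Real.quadratic_le_exp_of_nonneg (show (0 : ℝ) ≤ 2 by norm_num)]
  have h24 : (24 : ℝ) ≤ Real.exp 4 := by
    rw [show (4 : ℝ) = 2 + 2 by norm_num, Real.exp_add]
    nlinarith
  calc 24 * d ≤ Real.exp 4 * Real.exp y :=
        mul_le_mul h24 ((Real.log_le_iff_le_exp hd).1 hdy) hd.le (Real.exp_pos _).le
    _ = Real.exp (4 + y) := (Real.exp_add _ _).symm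
    _ ≤ Real.exp (Real.log (1 + γ) * (K * y)) := Real.exp_le_exp.2 (by nlinarith)
    _ = (1 + γ) ^ (K * y) := by rw [Real.rpow_def_of_pos (by linarith)]

theorem three_pow_mul_rpow_le {γ δ θ K y : ℝ} {N : ℕ} (hγ : 0 < γ) (hδ0 : 0 < δ)
    (hδ : (1 + γ) ^ (-(θ * (N : ℝ))) ≤ δ) (hK : 1 ≤ K)
    (hK1 : (K - 1) * (Real.log (1 + γ) * (1 - θ)) = 3) (hy : 1 ≤ y) :
    (3 : ℝ) ^ N * ((1 + γ) ^ (-(K * y))) ^ N * δ ^ (-(K * y)) ≤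
      Real.exp (-(y * ((N : ℝ) + Real.log δ))) := by
  have hg : (0 : ℝ) < 1 + γ := by linarith
  have h3 : (3 : ℝ) ≤ Real.exp 2 := by linarith [Real.add_one_le_exp (2 : ℝ)]
  have hlogδ : -(θ * N) * Real.log (1 + γ) ≤ Real.log δ := by
    rw [← Real.log_rpow hg]
    exact Real.log_le_log (by positivity) hδ
  set L : ℝ := Real.log (1 + γ) with hLdef
  have hL : 0 < L := Real.log_pos (by linarith)
  calc (3 : ℝ) ^ N * ((1 + γ) ^ (-(K * y))) ^ N * δ ^ (-(K * y))
      ≤ Real.exp 2 ^ N * ((1 + γ) ^ (-(K * y))) ^ N * δ ^ (-(K * y)) := by gcongr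
    _ = Real.exp (N * 2 + N * (L * -(K * y)) + Real.log δ * -(K * y)) := by
        rw [Real.rpow_def_of_pos hg, Real.rpow_def_of_pos hδ0, ← Real.exp_nat_mul,
          ← Real.exp_nat_mul, ← Real.exp_add, ← Real.exp_add]
    _ ≤ Real.exp (-(y * ((N : ℝ) + Real.log δ))) := by
        refine Real.exp_le_exp.2 ?_
        have hN : (0 : ℝ) ≤ N := by positivity
        -- Inserting `log δ ≥ -θNL` leaves `N ((K - 1) L (1 - θ) + L - 3) = N L ≥ 0`. Of the `3`,
        -- the term `2` pays for `3^N ≤ e^{2N}` and `1` for the `N` in the target.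
        have h4 : 0 ≤ (K - 1) * Real.log δ + N * (K * L - 3) := by
          have h5 := mul_le_mul_of_nonneg_left hlogδ (by linarith : 0 ≤ K - 1)
          have h6 : (N : ℝ) * ((K - 1) * (L * (1 - θ))) = N * 3 := by rw [hK1]
          have h7 : 0 ≤ (N : ℝ) * L := by positivity
          linarith
        have h8 := mul_nonneg (by linarith : 0 ≤ y) h4
        have h9 := mul_le_mul_of_nonneg_left hy hN
        linarith

end Parameters

/-! ### Growth comparisons for large `d` and `n`. -/

section Asymptotics

open Filter Asymptotics

theorem eventually_log_le_mul_rpow {ε s : ℝ} (hε : 0 < ε) (hs : 0 < s) :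
    ∀ᶠ x : ℝ in atTop, Real.log x ≤ ε * x ^ s := by
  filter_upwards [(isLittleO_log_rpow_atTop hs).bound hε, eventually_ge_atTop 0] with x hx hx0
  rw [Real.norm_of_nonneg (Real.rpow_nonneg hx0 s)] at hx
  exact (le_abs_self _).trans hx

theorem eventually_mul_log_add_le (d : ℝ) (hd : 0 < d) :
    ∀ᶠ n : ℕ in atTop, d * (Real.log n + 3) ≤ n := by
  have h1 := (tendsto_natCast_atTop_atTop (R := ℝ)).eventually
    (eventually_log_le_mul_rpow (ε := (2 * d)⁻¹) (by positivity) one_pos)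
  filter_upwards [h1, (tendsto_natCast_atTop_atTop (R := ℝ)).eventually
    (eventually_ge_atTop (6 * d))] with n hn hn2
  rw [Real.rpow_one, inv_mul_eq_div, le_div_iff₀ (by positivity)] at hn
  linarith

/-- The weight of a vertex of large degree is beaten by an exponential of the degree. -/
theorem eventually_weight_le_exp {α γ c K : ℝ} (hα : 0 < α) (hγ : 0 < γ) (hc : 0 < c)
    (hK : 0 < K) :
    ∀ᶠ d : ℝ in atTop, ∀ x : ℝ, (1 + α) * d < x →
      (d ^ c * x * (1 + γ)) ^ (K * d ^ (7 / 10 : ℝ)) ≤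
        Real.exp (-(α / 4 * (1 + 3 * α / 4) * d)) * Real.exp (α / 4 * x) := by
  -- Chosen so that `(1 - κ)(1 + α) = 1 + 3α/4`: the fraction `κ` of the exponent `αx/4` pays for
  -- the weight, and the rest still exceeds `(α/4)(1 + 3α/4) d`.
  set κ : ℝ := α / 4 / (1 + α) with hκ
  have hκ0 : 0 < κ := by positivity
  set ε : ℝ := α / 4 * κ / (K * (c + 2)) with hε
  have hε0 : 0 < ε := by positivity
  obtain ⟨X, hX⟩ := eventually_atTop.1
    (eventually_log_le_mul_rpow hε0 (show (0 : ℝ) < 3 / 10 by norm_num))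
  filter_upwards [eventually_ge_atTop X, eventually_ge_atTop (1 + γ)] with d hdX hdγ x hx
  have hd : 0 < d := by linarith
  have hdx : d ≤ x := by nlinarith
  have hx0 : 0 < x := by linarith
  have hlogx : 0 ≤ Real.log x := Real.log_nonneg (by linarith)
  have h1 : Real.log (d ^ c * x * (1 + γ)) ≤ (c + 2) * Real.log x := by
    rw [Real.log_mul (by positivity) (by positivity), Real.log_mul (by positivity) (by positivity),
      Real.log_rpow hd]
    have h2 : Real.log d ≤ Real.log x := Real.log_le_log hd hdx
    have h3 : Real.log (1 + γ) ≤ Real.log x := Real.log_le_log (by positivity) (by linarith)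
    nlinarith
  have h4 : K * d ^ (7 / 10 : ℝ) * Real.log (d ^ c * x * (1 + γ)) ≤ α / 4 * κ * x := by
    calc K * d ^ (7 / 10 : ℝ) * Real.log (d ^ c * x * (1 + γ))
        ≤ K * d ^ (7 / 10 : ℝ) * ((c + 2) * Real.log x) := by gcongr
      _ ≤ K * x ^ (7 / 10 : ℝ) * ((c + 2) * (ε * x ^ (3 / 10 : ℝ))) := by
          have := hX x (by linarith)
          gcongr
      _ = K * (c + 2) * ε * (x ^ (7 / 10 : ℝ) * x ^ (3 / 10 : ℝ)) := by ring
      _ = α / 4 * κ * x := by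
          rw [← Real.rpow_add hx0, hε]
          norm_num
          field_simp
          simp
  have h5 : (1 + 3 * α / 4) * d ≤ (1 - κ) * x := by
    have h6 : (1 - κ) * x = (1 + 3 * α / 4) * (x / (1 + α)) := by
      rw [hκ]; field_simp; ring
    rw [h6]
    have : d ≤ x / (1 + α) := by rw [le_div_iff₀ (by positivity)]; linarith
    gcongr
  rw [Real.rpow_def_of_pos (by positivity), ← Real.exp_add, Real.exp_le_exp]
  nlinarith

end Asymptotics

end WeightedPath

/-! ### The main theorem. -/

theorem mainTheorem9 (α γ c θ : ℝ) (hα : α ∈ Set.Ioo (0 : ℝ) (3 / 2)) (hγ : 0 < γ) (hc : 0 < c)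
    (hθ : θ ∈ Set.Ico (0 : ℝ) 1) :
    ∃ d₀ : ℝ, 1 < d₀ ∧ ∀ d : ℝ, d₀ ≤ d → ∃ n₀ : ℕ, ∀ n : ℕ, n₀ ≤ n →
      ∀ hp : d / (n : ℝ) ∈ unitInterval,
      ∀ N : ℕ, (N : ℝ) ≤ Real.log n / Real.log d ^ 2 →
      ∀ δ : ℝ, (1 + γ) ^ (-(θ * (N : ℝ))) ≤ δ →
        (WeightedPath.law N (n - 1) ⟨d / (n : ℝ), hp⟩).real
            {ω | δ ≤ WeightedPath.AC n d α γ c ω} ≤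
          2 * Real.exp (-(d ^ (7 / 10 : ℝ) * ((N : ℝ) + Real.log δ))) := by
  obtain ⟨hα0, hα1⟩ := hα
  obtain ⟨hθ0, hθ1⟩ := hθ
  have hg : (0 : ℝ) < 1 + γ := by linarith
  set L : ℝ := Real.log (1 + γ) with hLdef
  have hL : 0 < L := Real.log_pos (by linarith)
  have hθ' : 0 < 1 - θ := by linarith
  set K : ℝ := 1 + 3 / (L * (1 - θ)) with hKdef
  have hK1 : (K - 1) * (L * (1 - θ)) = 3 := by rw [hKdef]; field_simp; ring
  have hK0 : 1 < K := by rw [hKdef]; linarith [show 0 < 3 / (L * (1 - θ)) by positivity]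
  have hKL : 3 ≤ K * L := by nlinarith [mul_pos (sub_pos.2 hK0) hL]
  set l : ℝ := α / 4 with hl
  have hl0 : 0 < l := by positivity
  have hl1 : l ≤ 3 / 8 := by linarith
  have hel : Real.exp l ≤ 1 + l + l ^ 2 := by
    have := Real.abs_exp_sub_one_sub_id_le (x := l) (by rw [abs_of_pos hl0]; linarith)
    linarith [le_abs_self (Real.exp l - 1 - l)]
  have hel2 : Real.exp l ≤ 2 := by nlinarith
  have hlim : Filter.Tendsto (fun d : ℝ => d ^ (7 / 10 : ℝ)) Filter.atTop Filter.atTop :=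
    tendsto_rpow_atTop (by norm_num)
  obtain ⟨X, hX⟩ := Filter.eventually_atTop.1
    ((WeightedPath.eventually_weight_le_exp hα0 hγ hc (zero_lt_one.trans hK0)).and
      ((WeightedPath.eventually_log_le_mul_rpow one_pos (show (0 : ℝ) < 7 / 10 by norm_num)).and
        ((hlim.eventually (Filter.eventually_ge_atTop 2)).and
          (Filter.eventually_ge_atTop ((1 + 2 * l) / (l * α / 2))))))
  refine ⟨max X 2, lt_of_lt_of_le one_lt_two (le_max_right _ _), fun d hd => ?_⟩
  obtain ⟨hweight, hlog, hd7, hdl⟩ := hX d ((le_max_left _ _).trans hd)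
  have hd2 : 2 ≤ d := (le_max_right _ _).trans hd
  rw [div_le_iff₀ (by positivity)] at hdl
  obtain ⟨n₀, hn₀⟩ := Filter.eventually_atTop.1
    (WeightedPath.eventually_mul_log_add_le d (by linarith))
  refine ⟨max n₀ 1, fun n hn hp N _ δ hδ => ?_⟩
  have hn1 : 1 ≤ n := (le_max_right _ _).trans hn
  have hnpos : (0 : ℝ) < n := by exact_mod_cast hn1
  have hdn := hn₀ n ((le_max_left _ _).trans hn)
  have hδ0 : 0 < δ := lt_of_lt_of_le (by positivity) hδ
  set t : ℝ := K * d ^ (7 / 10 : ℝ) with ht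
  have ht0 : 0 < t := by positivity
  have hpm : d / (n : ℝ) * ((n - 1 : ℕ) : ℝ) ≤ d := by
    rw [div_mul_eq_mul_div, div_le_iff₀ hnpos]
    have : ((n - 1 : ℕ) : ℝ) ≤ n := by exact_mod_cast Nat.sub_le n 1
    gcongr
  have htail := WeightedPath.law_real_le_AC (N := N) (c := c) n ⟨d / (n : ℝ), hp⟩
    (by linarith) hγ ht0 (Real.exp_pos _).le hl0.le hel2 hδ0 hweight ?_ ?_ ?_
  · refine htail.trans ?_
    have h1 := WeightedPath.three_pow_mul_rpow_le hγ hδ0 hδ hK0.le hK1 (one_le_two.trans hd7)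
    exact h1.trans (by linarith [Real.exp_pos (-(d ^ (7 / 10 : ℝ) * ((N : ℝ) + Real.log δ)))])
  · rw [← Real.exp_add, Real.exp_le_one_iff]
    have h1 : d / (n : ℝ) * ((n - 1 : ℕ) : ℝ) * (Real.exp l - 1) ≤ d * (l + l ^ 2) :=
      mul_le_mul hpm (by linarith) (by linarith [Real.one_le_exp hl0.le]) (by linarith)
    -- The exponent of `A` exceeds the bound `d (l + l^2)` on `pm (e^l - 1)` by `d l α / 2`, which
    -- covers `1 + 2l` once `d` is large.
    have h2 : α / 4 * (1 + 3 * α / 4) * d = d * (l + l ^ 2) + d * (l * α / 2) := by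
      rw [hl]; ring
    simp only
    linarith
  · have h1 : Real.log n / d ^ (2 / 5 : ℝ) ≤ Real.log n :=
      div_le_self (Real.log_natCast_nonneg n) (Real.one_le_rpow (by linarith) (by norm_num))
    have h2 := Nat.floor_le (div_nonneg (Real.log_natCast_nonneg n)
      (Real.rpow_nonneg (by linarith : 0 ≤ d) (2 / 5 : ℝ)))
    simp only
    rw [div_mul_eq_mul_div, div_le_one hnpos]
    refine le_trans ?_ hdn
    gcongr
    linarith
  · have h1 : 24 * d ≤ (1 + γ) ^ t :=
      WeightedPath.mul_le_rpow hγ (by linarith) hd7 (by linarith) hKL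
    have h2 : Real.exp (2 * l) ≤ 4 := by
      rw [two_mul, Real.exp_add]
      linarith [mul_le_mul hel2 hel2 (Real.exp_pos l).le zero_le_two]
    have h3 : d / (n : ℝ) * ((n - 1 : ℕ) : ℝ) * Real.exp (2 * l) ≤ d * 4 :=
      mul_le_mul hpm h2 (Real.exp_pos _).le (by linarith)
    calc 2 * ((1 + γ) ^ (-t) * (d / (n : ℝ) * Real.exp (2 * l))) * ((n - 1 : ℕ) : ℝ)
        = 2 * (d / (n : ℝ) * ((n - 1 : ℕ) : ℝ) * Real.exp (2 * l)) / (1 + γ) ^ t := by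
          rw [Real.rpow_neg hg.le]; ring
      _ ≤ 1 / 3 := by
          rw [div_le_iff₀ (by positivity)]
          linarith
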